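/- Let $\mathcal M$ be a smooth Riemannian manifold (finite-dimensional, without boundary) with Riemannian distance $d_{\mathcal M}$, and suppose that $\mathcal M$ is geodesically complete: every geodesic (that is, every constant-speed, locally distance-minimizing curve) defined on an open interval extends to a geodesic defined on all of $\mathbb R$. Let $f:\mathcal M\times\mathbb R\to T\mathcal M$, $f(z,t)\in T_z\mathcal M$, be a time-dependent vector field which is $C^1$ (jointly in $(z,t)$) and bounded, i.e. there is $c\in\mathbb R$ with $\|f(z,t)\|_z\le c$ for all $z\in\mathcal M$, $t\in\mathbb R$. Then $f$ generates a global flow: there is a $C^1$ map $\phi:\mathcal M\times\mathbb R\to\mathcal M$ such that $$\phi(z,0)=z,\qquad \frac{\partial}{\partial t}\phi(z,t)=f(\phi(z,t),t)\qquad\text{for all } z\in\mathcal M,\ t\in\mathbb R.$$ It is the flow of $f$: every solution $\gamma:J\to\mathcal M$ of $\gamma'(t)=f(\gamma(t),t)$ on an open interval $J\ni 0$ satisfies $\gamma(t)=\phi(\gamma(0),t)$ for all $t\in J$. Moreover, for every $t\in\mathbb R$ the map $\phi(\cdot,t):\mathcal M\to\mathcal M$ is a $C^1$-diffeomorphism,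 i.e. a $C^1$ bijection with $C^1$ inverse. -/

import Mathlib

open scoped Bundle Manifold ContDiff NNReal

section Geodesic

/-- `γ` is a geodesic on the interval `J`: it has a constant speed `c`, and it is locally a shortest
path, i.e. every point of `J` has a neighbourhood in `J` on which the length `c * |s - s'|` of the
arc of `γ` between two parameters equals the distance of its end points. On a Riemannian manifold
the distance is the infimum of the lengths of curves. -/
def IsGeodesicOn {M : Type*} [EMetricSpace M] (γ : ℝ → M) (J : Set ℝ) : Prop :=
  ∃ c : ℝ≥0, ∀ t ∈ J, ∃ ε > 0, ∀ s ∈ J, ∀ s' ∈ J, |s - t| < ε → |s' - t| < ε →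
    edist (γ s) (γ s') = c * edist s s'

/-- Geodesic completeness: every geodesic on an open interval extends to a geodesic that is
defined for all times. -/
def GeodesicallyComplete (M : Type*) [EMetricSpace M] : Prop :=
  ∀ (γ : ℝ → M) (J : Set ℝ), IsOpen J → J.OrdConnected → IsGeodesicOn γ J →
    ∃ γ' : ℝ → M, IsGeodesicOn γ' Set.univ ∧ Set.EqOn γ' γ J

end Geodesic

section Flow

variable {E : Type*} [NormedAddCommGroup E] [NormedSpace ℝ E]
  {H : Type*} [TopologicalSpace H] (I : ModelWithCorners ℝ E H)
  {M : Type*} [TopologicalSpace M] [ChartedSpace H M]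

/-- The time-dependent vector field `f` is `C^1`, as a map `M × ℝ → TM`. -/
def IsC1TimeDependentField [IsManifold I 1 M] (f : (z : M) → ℝ → TangentSpace I z) : Prop :=
  ContMDiff (I.prod 𝓘(ℝ, ℝ)) I.tangent 1
    (fun p : M × ℝ ↦ (⟨p.1, f p.1 p.2⟩ : TangentBundle I M))

/-- `γ` solves `γ'(t) = f (γ t, t)` at all times of the open set `J`. -/
def SolvesOn (f : (z : M) → ℝ → TangentSpace I z) (γ : ℝ → M) (J : Set ℝ) : Prop :=
  ∀ t ∈ J, HasMFDerivAt 𝓘(ℝ, ℝ) I γ t ((1 : ℝ →L[ℝ] ℝ).smulRight (f (γ t) t))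

/-- `φ : M × ℝ → M` is a global `C^1` flow generated by the time-dependent vector field `f`. -/
structure IsGlobalFlow (f : (z : M) → ℝ → TangentSpace I z) (φ : M × ℝ → M) : Prop where
  contMDiff : ContMDiff (I.prod 𝓘(ℝ, ℝ)) I 1 φ
  map_zero : ∀ z, φ (z, 0) = z
  solves : ∀ z, SolvesOn I f (fun t ↦ φ (z, t)) Set.univ

end Flow

/-!
Closed balls of a geodesically complete length space are compact (Hopf–Rinow). If the balls of
radius less than `R` are compact, a sequence of points at distance at most `R` comes with almost
minimizing curves, which subconverge on `[0, R)` to a minimizing geodesic; by completeness this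
geodesic extends past time `R`, and its value there is a cluster point of the sequence. So the set
of radii of compact balls is closed, and it is open by local compactness.

The suspension `(f, 1)` on `M × ℝ` is an autonomous `C^1` field. Since `f` is bounded, an integral
curve stays in a compact set during bounded times, hence it is defined for all times. On a small
time interval, the curve `u` from `x` with velocity `s • v` satisfies `u = x + s ∫ v ∘ u` in
`C([0, 1], E)`, so by the implicit function theorem it is a `C^1` function of `(x, s)`; the group
law propagates this regularity to all times.
-/

open Set Filter Topology Manifold MeasureTheory
open scoped ENNReal

/-- A length space: points at distance less than `L` are joined by a curve of length at most `L`.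
The curve is parametrised by `[0, L]` with speed at most one. -/
def IsLengthSpace (X : Type*) [PseudoEMetricSpace X] : Prop :=
  ∀ (p x : X) (L : ℝ≥0), edist p x < L →
    ∃ y : ℝ → X, y 0 = p ∧ y L = x ∧ LipschitzOnWith 1 y (Icc 0 L)

theorem exists_lipschitzOnWith_comp_eqOn {α X Y : Type*} [EMetricSpace X]
    [PseudoEMetricSpace Y] [Nonempty α] {c : α → X} {g : α → Y} {s : Set α}
    (h : ∀ a ∈ s, ∀ b ∈ s, edist (c a) (c b) ≤ edist (g a) (g b)) :
    ∃ y : Y → X, LipschitzOnWith 1 y (g '' s) ∧ EqOn (y ∘ g) c s := by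
  have hinv {a : α} (ha : a ∈ s) :
      Function.invFunOn g s (g a) ∈ s ∧ g (Function.invFunOn g s (g a)) = g a :=
    Function.invFunOn_pos ⟨a, ha, rfl⟩
  refine ⟨c ∘ Function.invFunOn g s, ?_, fun a ha ↦ edist_le_zero.1 ?_⟩
  · rintro _ ⟨a, ha, rfl⟩ _ ⟨b, hb, rfl⟩
    simpa [(hinv ha).2, (hinv hb).2] using h _ (hinv ha).1 _ (hinv hb).1
  · simpa [(hinv ha).2] using h _ (hinv ha).1 a ha

section Length

variable {E : Type*} [NormedAddCommGroup E] [NormedSpace ℝ E]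
  {H : Type*} [TopologicalSpace H] {I : ModelWithCorners ℝ E H}

section ENorm

variable {M : Type*} [TopologicalSpace M] [ChartedSpace H M]
  [∀ x : M, ENorm (TangentSpace I x)] {γ : ℝ → M} {a b : ℝ}

theorem edist_toReal_pathELength (h : pathELength I γ a b ≠ ⊤) {s t : ℝ} (has : a ≤ s)
    (hst : s ≤ t) (htb : t ≤ b) :
    edist (pathELength I γ a s).toReal (pathELength I γ a t).toReal = pathELength I γ s t := by
  have hs : pathELength I γ a s ≠ ⊤ :=
    ne_top_of_le_ne_top h (pathELength_mono le_rfl (hst.trans htb))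
  have hst' : pathELength I γ s t ≠ ⊤ := ne_top_of_le_ne_top h (pathELength_mono has htb)
  rw [← pathELength_add has hst, ENNReal.toReal_add hs hst', edist_dist, Real.dist_eq,
    sub_add_cancel_left, abs_neg, abs_of_nonneg ENNReal.toReal_nonneg, ENNReal.ofReal_toReal hst']

theorem continuousOn_toReal_pathELength (h : pathELength I γ a b ≠ ⊤) :
    ContinuousOn (fun t ↦ (pathELength I γ a t).toReal) (Icc a b) := by
  intro t ht
  rw [ContinuousWithinAt, tendsto_iff_edist_tendsto_0]
  have hvol : Tendsto (volume.restrict (Icc a b) ∘ fun s ↦ uIcc s t) (𝓝[Icc a b] t) (𝓝 0) := by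
    have hlen : Tendsto (fun s ↦ volume (uIcc s t)) (𝓝[Icc a b] t) (𝓝 0) := by
      have : Continuous fun s ↦ ENNReal.ofReal |t - s| :=
        ENNReal.continuous_ofReal.comp (by fun_prop)
      simpa using (this.tendsto t).mono_left nhdsWithin_le_nhds
    exact tendsto_of_tendsto_of_tendsto_of_le_of_le tendsto_const_nhds hlen (fun _ ↦ zero_le)
      fun s ↦ Measure.restrict_apply_le _ _
  have hint := h
  rw [pathELength_eq_lintegral_mfderiv_Icc] at hint
  refine (tendsto_setLIntegral_zero hint hvol).congr' ?_
  filter_upwards [self_mem_nhdsWithin] with s hs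
  rw [Measure.restrict_restrict measurableSet_uIcc,
    inter_eq_left.2 (ordConnected_Icc.uIcc_subset hs ht)]
  rcases le_total s t with hst | hst
  · rw [uIcc_of_le hst, ← pathELength_eq_lintegral_mfderiv_Icc,
      edist_toReal_pathELength h hs.1 hst ht.2]
  · rw [uIcc_of_ge hst, ← pathELength_eq_lintegral_mfderiv_Icc, edist_comm,
      edist_toReal_pathELength h ht.1 hst hs.2]

end ENorm

variable {M : Type*} [EMetricSpace M] [ChartedSpace H M]
  [Bundle.RiemannianBundle (fun z : M ↦ TangentSpace I z)] [IsRiemannianManifold I M]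

theorem edist_le_pathELength {γ : ℝ → M} {s t : ℝ} (hγ : ContMDiffOn 𝓘(ℝ, ℝ) I 1 γ (Icc s t))
    (hst : s ≤ t) : edist (γ s) (γ t) ≤ pathELength I γ s t := by
  rw [IsRiemannianManifold.out (I := I)]
  exact riemannianEDist_le_pathELength hγ rfl rfl hst

theorem exists_lipschitzOnWith_of_pathELength_lt {c : ℝ → M} {L : ℝ≥0}
    (hc : ContMDiffOn 𝓘(ℝ, ℝ) I 1 c (Icc 0 1)) (hL : pathELength I c 0 1 < L) :
    ∃ y : ℝ → M, y 0 = c 0 ∧ y L = c 1 ∧ LipschitzOnWith 1 y (Icc 0 L) := by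
  have hfin : pathELength I c 0 1 ≠ ⊤ := hL.ne_top
  set ℓ : ℝ → ℝ := fun τ ↦ (pathELength I c 0 τ).toReal
  have hℓL : 0 ≤ L - ℓ 1 :=
    sub_nonneg.2 (ENNReal.toReal_le_of_le_ofReal L.2 (by simpa using hL.le))
  -- `ℓ` need not reach `L`: a linear term makes up for the difference.
  set g : ℝ → ℝ := fun τ ↦ ℓ τ + (L - ℓ 1) * τ
  have hg0 : g 0 = 0 := by simp [g, ℓ]
  have hg1 : g 1 = L := by simp [g]
  have hle {s t : ℝ} (hs : 0 ≤ s) (hst : s ≤ t) (ht : t ≤ 1) :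
      edist (c s) (c t) ≤ edist (g s) (g t) := by
    have hmono : ℓ s ≤ ℓ t := ENNReal.toReal_mono
      (ne_top_of_le_ne_top hfin (pathELength_mono le_rfl ht)) (pathELength_mono le_rfl hst)
    refine (edist_le_pathELength (hc.mono (Icc_subset_Icc hs ht)) hst).trans ?_
    rw [← edist_toReal_pathELength hfin hs hst ht, edist_comm, edist_comm (g s), edist_dist,
      edist_dist, Real.dist_eq, Real.dist_eq, abs_of_nonneg (sub_nonneg.2 hmono)]
    refine ENNReal.ofReal_le_ofReal (le_trans ?_ (le_abs_self _))
    simp only [g]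
    linarith [mul_le_mul_of_nonneg_left hst hℓL]
  obtain ⟨y, hy, hyc⟩ := exists_lipschitzOnWith_comp_eqOn (c := c) (g := g) (s := Icc 0 1)
    fun s hs t ht ↦ by
      rcases le_total s t with hst | hst
      · exact hle hs.1 hst ht.2
      · rw [edist_comm, edist_comm (g s)]
        exact hle ht.1 hst hs.2
  have hgc : ContinuousOn g (Icc 0 1) :=
    (continuousOn_toReal_pathELength hfin).add (by fun_prop)
  refine ⟨y, ?_, ?_, hy.mono ?_⟩
  · rw [← hyc (left_mem_Icc.2 zero_le_one), Function.comp_apply, hg0]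
  · rw [← hyc (right_mem_Icc.2 zero_le_one), Function.comp_apply, hg1]
  · simpa only [hg0, hg1] using intermediate_value_Icc zero_le_one hgc

end Length

theorem isLengthSpace_of_isRiemannianManifold
    {E : Type*} [NormedAddCommGroup E] [NormedSpace ℝ E]
    {H : Type*} [TopologicalSpace H] (I : ModelWithCorners ℝ E H)
    (M : Type*) [EMetricSpace M] [ChartedSpace H M]
    [Bundle.RiemannianBundle (fun z : M ↦ TangentSpace I z)] [IsRiemannianManifold I M] :
    IsLengthSpace M := by
  intro p x L hL
  rw [IsRiemannianManifold.out (I := I)] at hL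
  obtain ⟨c, rfl, rfl, hc, hlen⟩ := exists_lt_of_riemannianEDist_lt hL
  exact exists_lipschitzOnWith_of_pathELength_lt hc hlen

section HopfRinow

variable {M : Type*} [EMetricSpace M] {p : M} {R : ℝ≥0}

theorem IsLengthSpace.exists_isCompact_closedEBall_add [LocallyCompactSpace M]
    (hM : IsLengthSpace M) (hR : IsCompact (Metric.closedEBall p R)) :
    ∃ δ : ℝ≥0, 0 < δ ∧ IsCompact (Metric.closedEBall p (R + δ : ℝ≥0)) := by
  obtain ⟨δ, hδ, hK⟩ := hR.exists_isCompact_cthickening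
  lift δ to ℝ≥0 using hδ.le
  rw [NNReal.coe_pos] at hδ
  refine ⟨δ / 2, half_pos hδ, hK.of_isClosed_subset Metric.isClosed_closedEBall fun x hx ↦ ?_⟩
  rw [Metric.mem_closedEBall, edist_comm] at hx
  have hlt : R + δ / 2 < R + δ := add_lt_add_right (half_lt_self hδ) R
  obtain ⟨y, rfl, rfl, hy⟩ := hM p x (R + δ) (hx.trans_lt (ENNReal.coe_lt_coe.2 hlt))
  have hmem : (R : ℝ) ∈ Icc 0 ((R + δ : ℝ≥0) : ℝ) := ⟨R.2, by simp⟩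
  refine Metric.mem_cthickening_of_edist_le _ (y R) δ _ ?_ ?_
  · simpa [edist_dist] using hy hmem ⟨le_rfl, NNReal.coe_nonneg _⟩
  · simpa [edist_dist] using hy ⟨NNReal.coe_nonneg _, le_rfl⟩ hmem

theorem isGeodesicOn_of_edist_eq {γ : ℝ → M} {J : Set ℝ}
    (h : ∀ s ∈ J, ∀ t ∈ J, edist (γ s) (γ t) = edist s t) : IsGeodesicOn γ J :=
  ⟨1, fun _ _ ↦ ⟨1, one_pos, fun s hs s' hs' _ _ ↦ by simpa using h s hs s' hs'⟩⟩

theorem IsGeodesicOn.continuousOn {γ : ℝ → M} {J : Set ℝ} (h : IsGeodesicOn γ J) :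
    ContinuousOn γ J := by
  obtain ⟨c, hc⟩ := h
  intro t ht
  obtain ⟨ε, hε, h⟩ := hc t ht
  have hlip : LipschitzOnWith c γ (J ∩ Metric.ball t ε) := fun s hs s' hs' ↦
    (h s hs.1 s' hs'.1 hs.2 hs'.2).le
  exact (hlip.continuousOn t ⟨ht, Metric.mem_ball_self hε⟩).mono_of_mem_nhdsWithin
    (inter_mem_nhdsWithin J (Metric.ball_mem_nhds t hε))

section UltrafilterLimit

variable {ι : Type*} {U : Ultrafilter ι} {L : ι → ℝ≥0} {y : ι → ℝ → M}

theorem eventually_mem_Icc_of_tendsto {l : Filter ι} (hL : Tendsto L l (𝓝 R)) {t : ℝ}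
    (ht : t ∈ Ico 0 (R : ℝ)) : ∀ᶠ n in l, t ∈ Icc 0 (L n : ℝ) :=
  ((NNReal.tendsto_coe.2 hL).eventually (lt_mem_nhds ht.2)).mono fun _ hn ↦ ⟨ht.1, hn.le⟩

theorem exists_forall_tendsto_of_isCompact_closedEBall (hL : Tendsto L U (𝓝 R))
    (hy : ∀ n, LipschitzOnWith 1 (y n) (Icc 0 (L n))) (hy0 : ∀ n, y n 0 = p)
    (hc : ∀ r < R, IsCompact (Metric.closedEBall p r)) :
    ∃ γ : ℝ → M, ∀ t ∈ Ico 0 (R : ℝ), Tendsto (fun n ↦ y n t) U (𝓝 (γ t)) := by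
  have hlim (t : ℝ) : ∃ q, t ∈ Ico 0 (R : ℝ) → Tendsto (fun n ↦ y n t) U (𝓝 q) := by
    by_cases ht : t ∈ Ico 0 (R : ℝ)
    · have hmem : Metric.closedEBall p t.toNNReal ∈ U.map (fun n ↦ y n t) := by
        refine Ultrafilter.mem_map.2
          (mem_of_superset (eventually_mem_Icc_of_tendsto hL ht) fun n hn ↦ ?_)
        simpa [hy0, edist_dist, abs_of_nonneg ht.1, ENNReal.ofReal] using
          hy n hn ⟨le_rfl, NNReal.coe_nonneg _⟩
      obtain ⟨q, -, hq⟩ :=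
        (hc _ ((Real.toNNReal_lt_iff_lt_coe ht.1).2 ht.2)).ultrafilter_le_nhds' _ hmem
      exact ⟨q, fun _ ↦ hq⟩
    · exact ⟨p, fun h ↦ absurd h ht⟩
  exact ⟨fun t ↦ (hlim t).choose, fun t ↦ (hlim t).choose_spec⟩

theorem edist_eq_of_tendsto_of_lipschitzOnWith {l : Filter ι} [l.NeBot] (hL : Tendsto L l (𝓝 R))
    (hy : ∀ n, LipschitzOnWith 1 (y n) (Icc 0 (L n)))
    (hd : Tendsto (fun n ↦ edist (y n 0) (y n (L n))) l (𝓝 R)) {γ : ℝ → M}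
    (hγ : ∀ t ∈ Ico 0 (R : ℝ), Tendsto (fun n ↦ y n t) l (𝓝 (γ t))) {s t : ℝ}
    (hs : 0 ≤ s) (hst : s ≤ t) (ht : t < R) : edist (γ s) (γ t) = edist s t := by
  have hs' : s ∈ Ico 0 (R : ℝ) := ⟨hs, hst.trans_lt ht⟩
  have ht' : t ∈ Ico 0 (R : ℝ) := ⟨hs.trans hst, ht⟩
  have hlim : Tendsto (fun n ↦ edist (y n s) (y n t)) l (𝓝 (edist (γ s) (γ t))) :=
    (hγ s hs').edist (hγ t ht')
  have hle : edist (γ s) (γ t) ≤ edist s t := by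
    refine le_of_tendsto hlim ?_
    filter_upwards [eventually_mem_Icc_of_tendsto hL hs', eventually_mem_Icc_of_tendsto hL ht']
      with n hns hnt
    simpa using hy n hns hnt
  refine le_antisymm hle ?_
  have hge : (R : ℝ≥0∞) ≤ edist 0 s + edist (γ s) (γ t) + edist t R := by
    have hlimR : Tendsto (fun n ↦ edist t (L n : ℝ)) l (𝓝 (edist t R)) :=
      tendsto_const_nhds.edist (NNReal.tendsto_coe.2 hL)
    refine le_of_tendsto_of_tendsto hd ((tendsto_const_nhds.add hlim).add hlimR) ?_
    filter_upwards [eventually_mem_Icc_of_tendsto hL hs', eventually_mem_Icc_of_tendsto hL ht']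
      with n hns hnt
    have h0 : edist (y n 0) (y n s) ≤ edist 0 s := by
      simpa using hy n ⟨le_rfl, NNReal.coe_nonneg _⟩ hns
    have hR : edist (y n t) (y n (L n)) ≤ edist t (L n : ℝ) := by
      simpa using hy n hnt ⟨NNReal.coe_nonneg _, le_rfl⟩
    exact (edist_triangle4 _ _ _ _).trans (by gcongr)
  have hfin : edist (γ s) (γ t) ≠ ⊤ := ne_top_of_le_ne_top (edist_ne_top _ _) hle
  rw [← ENNReal.ofReal_toReal hfin] at hge ⊢
  simp only [edist_dist, Real.dist_eq, ← ENNReal.ofReal_coe_nnreal] at hge ⊢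
  rw [← ENNReal.ofReal_add (abs_nonneg _) ENNReal.toReal_nonneg,
    ← ENNReal.ofReal_add (by positivity) (abs_nonneg _),
    ENNReal.ofReal_le_ofReal_iff (by positivity), abs_of_nonpos (by linarith),
    abs_of_nonpos (by linarith)] at hge
  refine ENNReal.ofReal_le_ofReal ?_
  rw [abs_of_nonpos (by linarith)]
  linarith

theorem GeodesicallyComplete.exists_tendsto_of_lipschitzOnWith (hM : GeodesicallyComplete M)
    (hR : 0 < R) (hc : ∀ r < R, IsCompact (Metric.closedEBall p r))
    (hL : Tendsto L U (𝓝 R)) (hy : ∀ n, LipschitzOnWith 1 (y n) (Icc 0 (L n)))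
    (hy0 : ∀ n, y n 0 = p) (hd : Tendsto (fun n ↦ edist p (y n (L n))) U (𝓝 R)) :
    ∃ q, Tendsto (fun n ↦ y n (L n)) U (𝓝 q) := by
  obtain ⟨γ, hγ⟩ := exists_forall_tendsto_of_isCompact_closedEBall hL hy hy0 hc
  have hiso : ∀ s ∈ Ioo 0 (R : ℝ), ∀ t ∈ Ioo 0 (R : ℝ), edist (γ s) (γ t) = edist s t := by
    intro s hs t ht
    have hd' : Tendsto (fun n ↦ edist (y n 0) (y n (L n))) U (𝓝 R) := by simpa only [hy0]
    rcases le_total s t with hst | hst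
    · exact edist_eq_of_tendsto_of_lipschitzOnWith hL hy hd' hγ hs.1.le hst ht.2
    · rw [edist_comm, edist_comm s]
      exact edist_eq_of_tendsto_of_lipschitzOnWith hL hy hd' hγ ht.1.le hst hs.2
  obtain ⟨γ', hγ', heq⟩ :=
    hM γ (Ioo 0 R) isOpen_Ioo ordConnected_Ioo (isGeodesicOn_of_edist_eq hiso)
  refine ⟨γ' R, tendsto_iff_edist_tendsto_0.2 ?_⟩
  obtain ⟨d, -, hlim⟩ := isCompact_univ.ultrafilter_le_nhds'
    (U.map fun n ↦ edist (y n (L n)) (γ' R)) univ_mem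
  have hbound : ∀ t ∈ Ioo 0 (R : ℝ), d ≤ edist (R : ℝ) t + edist (γ' t) (γ' R) := by
    intro t ht
    have ht' := Ioo_subset_Ico_self ht
    have hlimR : Tendsto (fun n ↦ edist (L n : ℝ) t) U (𝓝 (edist (R : ℝ) t)) :=
      (NNReal.tendsto_coe.2 hL).edist tendsto_const_nhds
    rw [heq ht]
    refine le_of_tendsto_of_tendsto hlim
      (hlimR.add ((hγ t ht').edist (tendsto_const_nhds (x := γ' R)))) ?_
    filter_upwards [eventually_mem_Icc_of_tendsto hL ht'] with n hn
    refine (edist_triangle _ (y n t) _).trans ?_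
    gcongr
    simpa using hy n ⟨NNReal.coe_nonneg _, le_rfl⟩ hn
  have hcont : Continuous fun t ↦ edist (R : ℝ) t + edist (γ' t) (γ' R) := by
    have := continuousOn_univ.1 hγ'.continuousOn
    fun_prop
  have hd0 : d ≤ 0 := by
    refine ge_of_tendsto (x := 𝓝[<] (R : ℝ)) ?_
      (mem_of_superset (Ioo_mem_nhdsLT (NNReal.coe_pos.2 hR)) hbound)
    simpa using (hcont.tendsto (R : ℝ)).mono_left nhdsWithin_le_nhds
  rwa [nonpos_iff_eq_zero.1 hd0] at hlim

end UltrafilterLimit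

theorem IsLengthSpace.isCompact_closedEBall_of_forall_lt (hM : IsLengthSpace M)
    (hgeo : GeodesicallyComplete M) (hR : 0 < R)
    (hc : ∀ r < R, IsCompact (Metric.closedEBall p r)) :
    IsCompact (Metric.closedEBall p R) := by
  suffices hcl : ∀ x : ℕ → M, (∀ n, x n ∈ Metric.closedEBall p R) →
      ∃ q, MapClusterPt q atTop x by
    refine IsSeqCompact.isCompact fun x hx ↦ ?_
    obtain ⟨q, hq⟩ := hcl x hx
    obtain ⟨φ, hφ, hlim⟩ := hq.tendsto_subseq
    exact ⟨q, Metric.isClosed_closedEBall.mem_of_tendsto hlim (.of_forall fun n ↦ hx _), φ, hφ,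
      hlim⟩
  intro x hx
  have hxR (n : ℕ) : edist p (x n) ≤ R := by simpa [edist_comm] using hx n
  by_cases hr : ∃ r < R, ∃ᶠ n in atTop, x n ∈ Metric.closedEBall p r
  · obtain ⟨r, hrR, hfreq⟩ := hr
    obtain ⟨q, -, φ, hφ, hlim⟩ := (hc r hrR).tendsto_subseq' hfreq
    exact ⟨q, hlim.mapClusterPt.of_comp hφ.tendsto_atTop⟩
  · push Not at hr
    have hd : Tendsto (fun n ↦ edist p (x n)) atTop (𝓝 R) := by
      refine tendsto_order.2 ⟨fun r hrR ↦ ?_, fun r hrR ↦ .of_forall fun n ↦ (hxR n).trans_lt hrR⟩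
      lift r to ℝ≥0 using hrR.ne_top
      filter_upwards [hr r (ENNReal.coe_lt_coe.1 hrR)] with n hn
      simpa [edist_comm] using hn
    set L : ℕ → ℝ≥0 := fun n ↦ R + 1 / ((n : ℝ≥0) + 1)
    have hL : Tendsto L atTop (𝓝 R) := by
      simpa [L] using tendsto_const_nhds.add (tendsto_one_div_add_atTop_nhds_zero_nat (𝕜 := ℝ≥0))
    choose y hy0 hyx hy using fun n ↦ hM p (x n) (L n)
      ((hxR n).trans_lt (ENNReal.coe_lt_coe.2 (lt_add_of_pos_right R (by positivity))))
    have hU := Nat.hyperfilter_le_atTop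
    obtain ⟨q, hq⟩ := hgeo.exists_tendsto_of_lipschitzOnWith hR hc (hL.mono_left hU) hy hy0
      (by simpa only [hyx] using hd.mono_left hU)
    simp only [hyx] at hq
    exact ⟨q, hq.mapClusterPt.mono hU⟩

theorem IsLengthSpace.isCompact_closedEBall [LocallyCompactSpace M] (hM : IsLengthSpace M)
    (hgeo : GeodesicallyComplete M) (p : M) (R : ℝ≥0) : IsCompact (Metric.closedEBall p R) := by
  set S := {r : ℝ≥0 | IsCompact (Metric.closedEBall p r)}
  have hdown {r r' : ℝ≥0} (hr : r ∈ S) (hle : r' ≤ r) : r' ∈ S :=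
    IsCompact.of_isClosed_subset hr Metric.isClosed_closedEBall
      (Metric.closedEBall_subset_closedEBall (ENNReal.coe_le_coe.2 hle))
  by_contra hR
  have hbdd : BddAbove S := ⟨R, fun r hr ↦ le_of_not_ge fun hle ↦ hR (hdown hr hle)⟩
  have h0 : (0 : ℝ≥0) ∈ S := by simp [S]
  have hsup : sSup S ∈ S := by
    rcases (zero_le (a := sSup S)).eq_or_lt with heq | hlt
    · rwa [← heq]
    · refine hM.isCompact_closedEBall_of_forall_lt hgeo hlt fun r hr ↦ ?_
      obtain ⟨r', hr', hlt'⟩ := exists_lt_of_lt_csSup ⟨0, h0⟩ hr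
      exact hdown hr' hlt'.le
  obtain ⟨δ, hδ, hmem⟩ := hM.exists_isCompact_closedEBall_add hsup
  exact (le_csSup hbdd hmem).not_gt (lt_add_of_pos_right _ hδ)

end HopfRinow

section Superposition

variable {K G E F : Type*} [TopologicalSpace K] [CompactSpace K]
  [NormedAddCommGroup G] [NormedSpace ℝ G] [NormedAddCommGroup E] [NormedSpace ℝ E]
  [NormedAddCommGroup F] [NormedSpace ℝ F]

/-- The continuous bilinear map on functions that applies `B` pointwise. With the evaluation pairing
as `B`, it expresses the derivative of a superposition operator `u ↦ v ∘ u`. -/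
noncomputable def pointwiseBilin (B : G →L[ℝ] E →L[ℝ] F) : C(K, G) →L[ℝ] C(K, E) →L[ℝ] C(K, F) :=
  LinearMap.mkContinuous₂
    (LinearMap.mk₂ ℝ (fun a h ↦ ⟨fun t ↦ B (a t) (h t), by fun_prop⟩)
      (fun _ _ _ ↦ by ext; simp) (fun _ _ _ ↦ by ext; simp) (fun _ _ _ ↦ by ext; simp)
      (fun _ _ _ ↦ by ext; simp)) ‖B‖ fun a h ↦
    (ContinuousMap.norm_le _ (by positivity)).2 fun t ↦
      B.le_of_opNorm₂_le_of_le le_rfl (a.norm_coe_le_norm t) (h.norm_coe_le_norm t)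

theorem hasFDerivAt_continuousMap_comp {v : C(E, F)} {v' : C(E, E →L[ℝ] F)}
    (hv : ∀ x, HasFDerivAt v (v' x) x) (u : C(K, E)) :
    HasFDerivAt (fun u : C(K, E) ↦ v.comp u) (pointwiseBilin (.id ℝ _) (v'.comp u)) u := by
  rw [hasFDerivAt_iff_isLittleO_nhds_zero, Asymptotics.isLittleO_iff]
  intro c hc
  -- `v'` is uniformly continuous at the points of the compact set `u(K)`.
  obtain ⟨δ, hδ, hunif⟩ := Metric.mem_uniformity_dist.1
    ((isCompact_range u.continuous).uniformContinuousAt_of_continuousAt v'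
      (fun x _ ↦ v'.continuous.continuousAt) (Metric.dist_mem_uniformity hc))
  filter_upwards [Metric.ball_mem_nhds (0 : C(K, E)) hδ] with k hk
  rw [mem_ball_zero_iff] at hk
  refine (ContinuousMap.norm_le _ (by positivity)).2 fun t ↦ ?_
  have hkt : ‖k t‖ ≤ ‖k‖ := k.norm_coe_le_norm t
  have hmean := (convex_ball (u t) δ).norm_image_sub_le_of_norm_hasFDerivWithin_le' (𝕜 := ℝ)
    (f := v) (f' := v') (φ := v' (u t)) (C := c) (x := u t) (y := u t + k t)
    (fun x _ ↦ (hv x).hasFDerivWithinAt)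
    (fun x hx ↦ by
      rw [Metric.mem_ball, dist_comm] at hx
      rw [← dist_eq_norm, dist_comm]
      exact (hunif hx (mem_range_self t)).le)
    (Metric.mem_ball_self hδ) (by simpa using hkt.trans_lt hk)
  rw [add_sub_cancel_left] at hmean
  exact hmean.trans (mul_le_mul_of_nonneg_left hkt hc.le)

theorem contDiff_continuousMap_comp {v : C(E, F)} (hv : ContDiff ℝ 1 v) :
    ContDiff ℝ 1 (fun u : C(K, E) ↦ v.comp u) := by
  let v' : C(E, E →L[ℝ] F) := ⟨fderiv ℝ v, hv.continuous_fderiv one_ne_zero⟩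
  have hcont : Continuous fun u : C(K, E) ↦ pointwiseBilin (.id ℝ (E →L[ℝ] F)) (v'.comp u) :=
    (ContinuousLinearMap.continuous _).comp v'.continuous_postcomp
  exact contDiff_one_iff_hasFDerivAt.2 ⟨_, hcont,
    hasFDerivAt_continuousMap_comp fun x ↦ (hv.differentiable one_ne_zero x).hasFDerivAt⟩

end Superposition

section VectorSpaceFlow

variable {E : Type*} [NormedAddCommGroup E] [NormedSpace ℝ E]

/-- The primitive vanishing at `0` of a continuous function on `[0, 1]`, as an operator on
continuous functions. -/
noncomputable def primitiveCLM : C(Icc (0 : ℝ) 1, E) →L[ℝ] C(Icc (0 : ℝ) 1, E) :=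
  LinearMap.mkContinuous
    { toFun := fun u ↦ ⟨fun t ↦ ∫ τ in (0 : ℝ)..t, IccExtend zero_le_one u τ,
        (intervalIntegral.continuous_primitive
          (fun a b ↦ (u.continuous.Icc_extend').intervalIntegrable a b) 0).comp
          continuous_subtype_val⟩
      map_add' := fun u w ↦ by
        ext t
        exact intervalIntegral.integral_add (u.continuous.Icc_extend'.intervalIntegrable _ _)
          (w.continuous.Icc_extend'.intervalIntegrable _ _)
      map_smul' := fun c u ↦ by
        ext t
        exact intervalIntegral.integral_smul c _ } 1 fun u ↦ by
    rw [one_mul]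
    refine (ContinuousMap.norm_le _ (norm_nonneg _)).2 fun t ↦ ?_
    refine (intervalIntegral.norm_integral_le_of_norm_le_const (C := ‖u‖)
      fun τ _ ↦ u.norm_coe_le_norm _).trans ?_
    rw [sub_zero, abs_of_nonneg t.2.1]
    exact mul_le_of_le_one_right (norm_nonneg _) t.2.2

variable [CompleteSpace E] {v : C(E, E)}

theorem exists_contDiffAt_eq_add_smul_primitiveCLM (hv : ContDiff ℝ 1 v) (x₀ : E) :
    ∃ u : E × ℝ → C(Icc (0 : ℝ) 1, E), ContDiffAt ℝ 1 u (x₀, 0) ∧ ∀ᶠ p in 𝓝 (x₀, (0 : ℝ)),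
      u p = .const _ p.1 + p.2 • primitiveCLM (v.comp (u p)) := by
  let G : (E × ℝ) × C(Icc (0 : ℝ) 1, E) → C(Icc (0 : ℝ) 1, E) := fun q ↦
    q.2 - ContinuousLinearMap.const ℝ (Icc (0 : ℝ) 1) q.1.1
      - q.1.2 • primitiveCLM (v.comp q.2)
  have hG : ContDiff ℝ 1 G := by
    have hcomp : ContDiff ℝ 1 fun q : (E × ℝ) × C(Icc (0 : ℝ) 1, E) ↦ v.comp q.2 :=
      (contDiff_continuousMap_comp hv).comp contDiff_snd
    fun_prop
  let q₀ : (E × ℝ) × C(Icc (0 : ℝ) 1, E) := ((x₀, 0), .const _ x₀)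
  have hid : fderiv ℝ G q₀ ∘L .inr ℝ (E × ℝ) C(Icc (0 : ℝ) 1, E) = .id ℝ _ := by
    have hpartial : HasFDerivAt (fun w ↦ G (q₀.1, w)) (fderiv ℝ G q₀ ∘L .inr ℝ (E × ℝ) _) q₀.2 :=
      (hG.differentiable one_ne_zero q₀).hasFDerivAt.comp q₀.2 (hasFDerivAt_prodMk_right _ _)
    have hsub : HasFDerivAt (fun w ↦ G (q₀.1, w)) (.id ℝ _) q₀.2 := by
      simpa [G, q₀] using (hasFDerivAt_id q₀.2).sub_const (ContinuousLinearMap.const ℝ _ x₀)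
    exact hpartial.unique hsub
  have hinv : (fderiv ℝ G q₀ ∘L .inr ℝ (E × ℝ) C(Icc (0 : ℝ) 1, E)).IsInvertible :=
    hid ▸ ⟨.refl ℝ _, rfl⟩
  refine ⟨hG.contDiffAt.implicitFunction one_ne_zero hinv,
    hG.contDiffAt.contDiffAt_implicitFunction one_ne_zero hinv, ?_⟩
  have hG₀ : G q₀ = 0 := by
    ext
    simp [G, q₀]
  filter_upwards [hG.contDiffAt.eventually_apply_implicitFunction one_ne_zero hinv] with p hp
  exact eq_add_of_sub_eq' (sub_eq_zero.1 (hp.trans hG₀))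

theorem eq_of_eq_add_smul_primitiveCLM {C : ℝ≥0} (hv : LipschitzWith C v) {x : E} {s : ℝ}
    {u : C(Icc (0 : ℝ) 1, E)} (hu : u = .const _ x + s • primitiveCLM (v.comp u)) {β : ℝ → E}
    (hβ0 : β 0 = x) (hβ : ∀ t ∈ Icc (0 : ℝ) 1, HasDerivAt β (s • v (β t)) t)
    (t : Icc (0 : ℝ) 1) : β t = u t := by
  let F : ℝ → E := fun t ↦ x + s • ∫ τ in (0 : ℝ)..t, v (IccExtend zero_le_one u τ)
  have hF (t : Icc (0 : ℝ) 1) : F t = u t := (DFunLike.congr_fun hu t).symm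
  have hFd (t : ℝ) (ht : t ∈ Icc (0 : ℝ) 1) : HasDerivAt F (s • v (F t)) t := by
    have hc : Continuous fun τ ↦ v (IccExtend zero_le_one u τ) :=
      v.continuous.comp u.continuous.Icc_extend'
    have := ((hc.integral_hasStrictDerivAt 0 t).hasDerivAt.const_smul s).const_add x
    rwa [IccExtend_of_mem _ _ ht, ← hF] at this
  have hEq : EqOn β F (Icc 0 1) :=
    ODE_solution_unique (v := fun _ x ↦ s • v x) (K := ‖s‖₊ * C)
      (fun _ ↦ (lipschitzWith_smul s).comp hv)
      (fun t ht ↦ (hβ t ht).continuousAt.continuousWithinAt)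
      (fun t ht ↦ (hβ t (Ico_subset_Icc_self ht)).hasDerivWithinAt)
      (fun t ht ↦ (hFd t ht).continuousAt.continuousWithinAt)
      (fun t ht ↦ (hFd t (Ico_subset_Icc_self ht)).hasDerivWithinAt) (by simpa [F] using hβ0)
  rw [hEq t.2, hF]

theorem contDiffAt_localFlow_of_lipschitzWith (hv : ContDiff ℝ 1 v) {C : ℝ≥0}
    (hC : LipschitzWith C v) {x₀ : E} {α : E → ℝ → E}
    (hα : ∀ᶠ p in 𝓝 x₀ ×ˢ 𝓝 (0 : ℝ), α p.1 0 = p.1 ∧ HasDerivAt (α p.1) (v (α p.1 p.2)) p.2) :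
    ContDiffAt ℝ 1 (fun p : E × ℝ ↦ α p.1 p.2) (x₀, 0) := by
  obtain ⟨u, hu, heq⟩ := exists_contDiffAt_eq_add_smul_primitiveCLM hv x₀
  let e : Icc (0 : ℝ) 1 := ⟨1, right_mem_Icc.2 zero_le_one⟩
  have hend : ContDiffAt ℝ 1 (fun p ↦ u p e) (x₀, 0) :=
    (ContinuousMap.evalCLM (M := E) ℝ e).contDiff.contDiffAt.comp (x₀, 0) hu
  refine hend.congr_of_eventuallyEq ?_
  obtain ⟨U, hU, V, hV, hUV⟩ := mem_prod_iff.1 hα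
  obtain ⟨ε, hε, hεV⟩ := Metric.mem_nhds_iff.1 hV
  filter_upwards [heq, prod_mem_nhds hU (Metric.ball_mem_nhds (0 : ℝ) hε)] with ⟨x, s⟩ hu hxs
  have hmem {t : ℝ} (ht : t ∈ Icc (0 : ℝ) 1) : (x, s * t) ∈ U ×ˢ V := by
    refine ⟨hxs.1, hεV ?_⟩
    have hs : |s| < ε := by simpa using hxs.2
    simpa [abs_mul, abs_of_nonneg ht.1] using
      (mul_le_of_le_one_right (abs_nonneg s) ht.2).trans_lt hs
  have hscaled (t : ℝ) (ht : t ∈ Icc (0 : ℝ) 1) :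
      HasDerivAt (fun t ↦ α x (s * t)) (s • v (α x (s * t))) t :=
    (hUV (hmem ht)).2.scomp t (hasDerivAt_const_mul s)
  have h0 : α x (s * 0) = x := by
    simpa using (hUV (hmem (left_mem_Icc.2 zero_le_one))).1
  simpa [e] using eq_of_eq_add_smul_primitiveCLM hC hu h0 hscaled e

end VectorSpaceFlow

section FiniteDimensional

variable {E F : Type*} [NormedAddCommGroup E] [NormedSpace ℝ E] [FiniteDimensional ℝ E]
  [NormedAddCommGroup F] [NormedSpace ℝ F]

theorem exists_contDiff_hasCompactSupport_eventuallyEq {n : ℕ} {v : E → F} {x₀ : E}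
    (hv : ContDiffAt ℝ n v x₀) :
    ∃ w : E → F, ContDiff ℝ n w ∧ HasCompactSupport w ∧ w =ᶠ[𝓝 x₀] v := by
  obtain ⟨U, hU, hvU⟩ := hv.contDiffOn le_rfl (by simp)
  obtain ⟨r, hr, hrU⟩ := Metric.mem_nhds_iff.1 hU
  let χ : ContDiffBump x₀ := ⟨r / 4, r / 2, by positivity, by linarith⟩
  refine ⟨fun x ↦ χ x • v x, contMDiff_iff_contDiff.1 (contMDiff_of_tsupport fun x hx ↦ ?_),
    χ.hasCompactSupport.smul_right, ?_⟩
  · have hx' : x ∈ Metric.closedBall x₀ (r / 2) := by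
      rw [← χ.tsupport_eq]
      exact tsupport_smul_subset_left _ _ hx
    have hxU : U ∈ 𝓝 x := mem_of_superset
      (Metric.isOpen_ball.mem_nhds (Metric.closedBall_subset_ball (by linarith) hx')) hrU
    exact (χ.contDiffAt.smul (hvU.contDiffAt hxU)).contMDiffAt
  · filter_upwards [χ.eventuallyEq_one] with x hx
    simp [hx]

theorem exists_contDiffAt_localFlow {v : E → E} {x₀ : E} (hv : ContDiffAt ℝ 1 v x₀) :
    ∃ α : E → ℝ → E, ContDiffAt ℝ 1 (fun p : E × ℝ ↦ α p.1 p.2) (x₀, 0) ∧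
      ∀ᶠ p in 𝓝 x₀ ×ˢ 𝓝 (0 : ℝ), α p.1 0 = p.1 ∧ HasDerivAt (α p.1) (v (α p.1 p.2)) p.2 := by
  have : CompleteSpace E := FiniteDimensional.complete ℝ E
  obtain ⟨w, hw, hsupp, hwv⟩ := exists_contDiff_hasCompactSupport_eventuallyEq (n := 1) hv
  obtain ⟨C, hC⟩ := hw.lipschitzWith_of_hasCompactSupport hsupp one_ne_zero
  obtain ⟨α, hα⟩ := hw.contDiffAt.exists_eventually_eq_hasDerivAt (x₀ := x₀) 0
  have hαd := contDiffAt_localFlow_of_lipschitzWith (v := ⟨w, hw.continuous⟩) hw hC hα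
  refine ⟨α, hαd, ?_⟩
  have h0 : α x₀ 0 = x₀ := by
    rw [← nhds_prod_eq] at hα
    exact hα.self_of_nhds.1
  have hlim : Tendsto (fun p : E × ℝ ↦ α p.1 p.2) (𝓝 x₀ ×ˢ 𝓝 0) (𝓝 x₀) := by
    simpa only [ContinuousAt, nhds_prod_eq, h0] using hαd.continuousAt
  filter_upwards [hα, hlim.eventually hwv] with p hp hwp
  exact ⟨hp.1, hwp ▸ hp.2⟩

end FiniteDimensional

section LocalFlow

variable {E : Type*} [NormedAddCommGroup E] [NormedSpace ℝ E]
  {H : Type*} [TopologicalSpace H] {I : ModelWithCorners ℝ E H}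
  {M : Type*} [TopologicalSpace M] [ChartedSpace H M]
  {v : (x : M) → TangentSpace I x} {x₀ : M}

theorem extChartAt_target_mem_nhds_of_isInteriorPoint (hx : I.IsInteriorPoint x₀) :
    (extChartAt I x₀).target ∈ 𝓝 (extChartAt I x₀ x₀) :=
  mem_interior_iff_mem_nhds.1 (I.isInteriorPoint_iff.1 hx)

variable [IsManifold I 1 M]

/-- The vector field `v` read in the chart at `x₀`, a vector field on the model space `E`. It is
meaningful on the target of the chart only. -/
noncomputable def chartField (v : (x : M) → TangentSpace I x) (x₀ : M) (y : E) : E :=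
  tangentCoordChange I ((extChartAt I x₀).symm y) x₀ ((extChartAt I x₀).symm y)
    (v ((extChartAt I x₀).symm y))

theorem contMDiffAt_extChartAt_symm_of_isInteriorPoint (hx : I.IsInteriorPoint x₀) :
    ContMDiffAt 𝓘(ℝ, E) I 1 (extChartAt I x₀).symm (extChartAt I x₀ x₀) :=
  (contMDiffOn_extChartAt_symm x₀).contMDiffAt (extChartAt_target_mem_nhds_of_isInteriorPoint hx)

theorem contDiffAt_chartField (hx : I.IsInteriorPoint x₀) (hv : CMDiffAt 1 (T% v) x₀) :
    ContDiffAt ℝ 1 (chartField v x₀) (extChartAt I x₀ x₀) := by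
  rw [Bundle.contMDiffAt_section] at hv
  exact (hv.comp_of_eq (contMDiffAt_extChartAt_symm_of_isInteriorPoint hx)
    (extChartAt_to_inv x₀)).contDiffAt

theorem mfderivWithin_extChartAt_symm_chartField {y : E} (hy : y ∈ (extChartAt I x₀).target) :
    mfderivWithin 𝓘(ℝ, E) I (extChartAt I x₀).symm (range I) y (chartField (E := E) v x₀ y) =
      v ((extChartAt I x₀).symm y) := by
  have hsource : (extChartAt I x₀).symm y ∈ (chartAt H x₀).source :=
    extChartAt_source I x₀ ▸ (extChartAt I x₀).map_target hy
  have hsymm := TangentBundle.symmL_trivializationAt (I := I) hsource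
  rw [(extChartAt I x₀).right_inv hy] at hsymm
  let e := trivializationAt E (fun x : M ↦ TangentSpace I x) x₀
  rw [← hsymm]
  refine Eq.trans (congrArg (e.symmL ℝ _) ?_) (e.symmL_continuousLinearMapAt (R := ℝ) hsource _)
  exact (e.continuousLinearMapAt_apply_of_mem (R := ℝ) hsource _).symm

theorem hasMFDerivAt_extChartAt_symm_comp {f : ℝ → E} {t : ℝ}
    (hf : (extChartAt I x₀).target ∈ 𝓝 (f t)) (hd : HasDerivAt f (chartField v x₀ (f t)) t) :
    HasMFDerivAt 𝓘(ℝ, ℝ) I ((extChartAt I x₀).symm ∘ f) t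
      ((1 : ℝ →L[ℝ] ℝ).smulRight (v ((extChartAt I x₀).symm (f t)))) := by
  have hft := mem_of_mem_nhds hf
  have hrange : range I ∈ 𝓝 (f t) := mem_of_superset hf (extChartAt_target_subset_range x₀)
  have hsymm := ((mdifferentiableWithinAt_extChartAt_symm hft).mdifferentiableAt
    hrange).hasMFDerivAt
  have hfield := mfderivWithin_extChartAt_symm_chartField (v := v) hft
  rw [mfderivWithin_of_mem_nhds hrange] at hfield
  refine (hsymm.comp t hd.hasFDerivAt.hasMFDerivAt).congr_mfderiv
    (ContinuousLinearMap.ext fun s : ℝ ↦ ?_)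
  exact (map_smul (mfderiv 𝓘(ℝ, E) I (extChartAt I x₀).symm (f t)) s
    (chartField (E := E) v x₀ (f t))).trans (congrArg (fun w : E ↦ s • w) hfield)

variable [FiniteDimensional ℝ E]

theorem exists_contMDiffAt_chartFlow (hx : I.IsInteriorPoint x₀) (hv : CMDiffAt 1 (T% v) x₀) :
    ∃ ψ : M × ℝ → M, ContMDiffAt (I.prod 𝓘(ℝ, ℝ)) I 1 ψ (x₀, 0) ∧
      ∀ᶠ p in 𝓝 x₀ ×ˢ 𝓝 (0 : ℝ), ψ (p.1, 0) = p.1 ∧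
        HasMFDerivAt 𝓘(ℝ, ℝ) I (fun t ↦ ψ (p.1, t)) p.2
          ((1 : ℝ →L[ℝ] ℝ).smulRight (v (ψ p))) := by
  obtain ⟨α, hα, hflow⟩ := exists_contDiffAt_localFlow (contDiffAt_chartField hx hv)
  have h0 : α (extChartAt I x₀ x₀) 0 = extChartAt I x₀ x₀ := by
    rw [← nhds_prod_eq] at hflow
    exact hflow.self_of_nhds.1
  have hcoord : ContMDiffAt (I.prod 𝓘(ℝ, ℝ)) 𝓘(ℝ, E × ℝ) 1
      (fun p : M × ℝ ↦ (extChartAt I x₀ p.1, p.2)) (x₀, 0) :=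
    (contMDiffAt_extChartAt.comp (x₀, (0 : ℝ)) contMDiffAt_fst).prodMk_space contMDiffAt_snd
  have hα' : ContMDiffAt (I.prod 𝓘(ℝ, ℝ)) 𝓘(ℝ, E) 1
      (fun p : M × ℝ ↦ α (extChartAt I x₀ p.1) p.2) (x₀, 0) :=
    ContMDiffAt.comp (x₀, (0 : ℝ)) (g := fun p : E × ℝ ↦ α p.1 p.2) hα.contMDiffAt hcoord
  refine ⟨fun p ↦ (extChartAt I x₀).symm (α (extChartAt I x₀ p.1) p.2),
    (contMDiffAt_extChartAt_symm_of_isInteriorPoint hx).comp_of_eq hα' h0, ?_⟩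
  have htarget : ∀ᶠ p : M × ℝ in 𝓝 (x₀, 0),
      (extChartAt I x₀).target ∈ 𝓝 (α (extChartAt I x₀ p.1) p.2) := by
    refine hα'.continuousAt.eventually (eventually_mem_nhds_iff.2 ?_)
    simpa only [h0] using extChartAt_target_mem_nhds_of_isInteriorPoint hx
  have hflow' := ((continuousAt_extChartAt (I := I) x₀).tendsto.prodMap tendsto_id).eventually hflow
  have hsource : ∀ᶠ p : M × ℝ in 𝓝 x₀ ×ˢ 𝓝 0, p.1 ∈ (extChartAt I x₀).source :=
    tendsto_fst.eventually (extChartAt_source_mem_nhds x₀)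
  rw [nhds_prod_eq] at htarget
  filter_upwards [hflow', htarget, hsource] with p hp hpt hps
  exact ⟨(congrArg _ hp.1).trans ((extChartAt I x₀).left_inv hps),
    hasMFDerivAt_extChartAt_symm_comp hpt hp.2⟩

theorem exists_contMDiffAt_localFlow (hx : I.IsInteriorPoint x₀) (hv : CMDiffAt 1 (T% v) x₀) :
    ∃ ψ : M × ℝ → M, ContMDiffAt (I.prod 𝓘(ℝ, ℝ)) I 1 ψ (x₀, 0) ∧
      ∃ U ∈ 𝓝 x₀, ∃ ε > 0, ∀ x ∈ U, ψ (x, 0) = x ∧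
        IsMIntegralCurveOn (fun t ↦ ψ (x, t)) v (Ioo (-ε) ε) := by
  obtain ⟨ψ, hψ, hflow⟩ := exists_contMDiffAt_chartFlow hx hv
  obtain ⟨U, hU, W, hW, hUW⟩ := mem_prod_iff.1 hflow
  obtain ⟨ε, hε, hεW⟩ := Metric.mem_nhds_iff.1 hW
  rw [Real.ball_eq_Ioo, zero_sub, zero_add] at hεW
  exact ⟨ψ, hψ, U, hU, ε, hε, fun x hx ↦ ⟨(hUW (mk_mem_prod hx (mem_of_mem_nhds hW))).1,
    fun t ht ↦ (hUW (mk_mem_prod hx (hεW ht))).2.hasMFDerivWithinAt⟩⟩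

variable [BoundarylessManifold I M]

theorem contMDiffAt_of_isMIntegralCurveAt {γ : ℝ → M} {t₀ : ℝ}
    (hv : CMDiffAt 1 (T% v) (γ t₀)) (hγ : IsMIntegralCurveAt γ v t₀) :
    ContMDiffAt 𝓘(ℝ, ℝ) I 1 γ t₀ := by
  obtain ⟨ψ, hψ, U, hU, ε, hε, h⟩ :=
    exists_contMDiffAt_localFlow BoundarylessManifold.isInteriorPoint hv
  obtain ⟨h0, hcurve⟩ := h _ (mem_of_mem_nhds hU)
  have hshift : IsMIntegralCurveAt (fun t ↦ ψ (γ t₀, t - t₀)) v t₀ := by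
    have hcurve0 := hcurve.isMIntegralCurveAt (Ioo_mem_nhds (neg_neg_of_pos hε) hε)
    simpa only [zero_add] using! (isMIntegralCurveAt_comp_sub (dt := t₀)).2 hcurve0
  have heq : γ =ᶠ[𝓝 t₀] fun t ↦ ψ (γ t₀, t - t₀) :=
    isMIntegralCurveAt_eventuallyEq_of_contMDiffAt_boundaryless hv hγ hshift (by simp [h0])
  have hpair : ContMDiffAt 𝓘(ℝ, ℝ) (I.prod 𝓘(ℝ, ℝ)) 1 (fun t ↦ (γ t₀, t - t₀)) t₀ :=
    contMDiffAt_const.prodMk (contDiffAt_id.sub contDiffAt_const).contMDiffAt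
  exact (hψ.comp_of_eq hpair (by simp)).congr_of_eventuallyEq heq

theorem exists_forall_mem_isMIntegralCurveOn_of_isCompact (hv : CMDiff 1 (T% v)) {K : Set M}
    (hK : IsCompact K) :
    ∃ ε > 0, ∀ x ∈ K, ∃ γ : ℝ → M, γ 0 = x ∧ IsMIntegralCurveOn γ v (Ioo (-ε) ε) := by
  refine hK.induction_on ⟨1, one_pos, fun _ ↦ False.elim⟩ ?_ ?_ fun x _ ↦ ?_
  · rintro s t hst ⟨ε, hε, ht⟩
    exact ⟨ε, hε, fun x hx ↦ ht x (hst hx)⟩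
  · rintro s t ⟨ε, hε, hs⟩ ⟨δ, hδ, ht⟩
    refine ⟨min ε δ, lt_min hε hδ, fun x hx ↦ ?_⟩
    obtain ⟨η, hη, γ, h0, hγ⟩ : ∃ η ≥ min ε δ, ∃ γ : ℝ → M, γ 0 = x ∧
        IsMIntegralCurveOn γ v (Ioo (-η) η) :=
      hx.elim (fun hx ↦ ⟨ε, min_le_left ε δ, hs x hx⟩) fun hx ↦ ⟨δ, min_le_right ε δ, ht x hx⟩
    exact ⟨γ, h0, hγ.mono (Ioo_subset_Ioo (neg_le_neg hη) hη)⟩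
  · obtain ⟨ψ, -, U, hU, ε, hε, h⟩ :=
      exists_contMDiffAt_localFlow BoundarylessManifold.isInteriorPoint (hv x)
    exact ⟨U, mem_nhdsWithin_of_mem_nhds hU, ε, hε, fun y hy ↦ ⟨fun t ↦ ψ (y, t), h y hy⟩⟩

end LocalFlow

section GlobalFlow

variable {E : Type*} [NormedAddCommGroup E] [NormedSpace ℝ E]
  {H : Type*} [TopologicalSpace H] {I : ModelWithCorners ℝ E H}
  {M : Type*} [TopologicalSpace M] [ChartedSpace H M] [IsManifold I 1 M]
  [BoundarylessManifold I M] [T2Space M] {v : (x : M) → TangentSpace I x}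

theorem exists_isMIntegralCurveOn_Ioo_union_Ioo (hv : CMDiff 1 (T% v)) {γ σ : ℝ → M}
    {a b t ε : ℝ} (hγ : IsMIntegralCurveOn γ v (Ioo a b)) (ht : t ∈ Ioo a b) (hε : 0 < ε)
    (hσ : IsMIntegralCurveOn σ v (Ioo (-ε) ε)) (h0 : σ 0 = γ t) :
    ∃ γ' : ℝ → M, EqOn γ' γ (Ioo a b) ∧
      IsMIntegralCurveOn γ' v (Ioo a b ∪ Ioo (t - ε) (t + ε)) := by
  classical
  have hσ' : IsMIntegralCurveOn (σ ∘ (· - t)) v (Ioo (t - ε) (t + ε)) := by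
    refine (isMIntegralCurveOn_comp_sub.2 hσ).mono fun s hs ↦ ?_
    constructor <;> linarith [hs.1, hs.2]
  exact ⟨(Ioo a b).piecewise γ (σ ∘ (· - t)), piecewise_eqOn _ _ _,
    isMIntegralCurveOn_piecewise hv hγ hσ' ⟨ht, by simpa using hε⟩ (by simp [h0])⟩

theorem exists_isMIntegralCurveOn_Ioo_add_half (hv : CMDiff 1 (T% v)) {γ : ℝ → M} {a ε : ℝ}
    (ha : 0 < a) (hε : 0 < ε) (hγ : IsMIntegralCurveOn γ v (Ioo (-a) a))
    (hrestart : ∀ t ∈ Ioo (-a) a, ∃ σ : ℝ → M, σ 0 = γ t ∧ IsMIntegralCurveOn σ v (Ioo (-ε) ε)) :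
    ∃ γ' : ℝ → M, γ' 0 = γ 0 ∧ IsMIntegralCurveOn γ' v (Ioo (-(a + ε / 2)) (a + ε / 2)) := by
  obtain ⟨t, ht0, hta, hat⟩ : ∃ t, 0 ≤ t ∧ t < a ∧ a - ε / 2 ≤ t :=
    ⟨max 0 (a - ε / 2), le_max_left _ _, max_lt ha (by linarith), le_max_right _ _⟩
  obtain ⟨σ, hσ0, hσ⟩ := hrestart t ⟨by linarith, hta⟩
  obtain ⟨γ₁, heq₁, hγ₁⟩ :=
    exists_isMIntegralCurveOn_Ioo_union_Ioo hv hγ ⟨by linarith, hta⟩ hε hσ hσ0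
  obtain ⟨τ, hτ0, hτ⟩ := hrestart (-t) ⟨neg_lt_neg hta, by linarith⟩
  have hright : IsMIntegralCurveOn γ₁ v (Ioo (-a) (a + ε / 2)) :=
    hγ₁.mono (Ioo_subset_Ioo_union_Ioo le_rfl (by linarith) (by linarith))
  obtain ⟨γ₂, heq₂, hγ₂⟩ := exists_isMIntegralCurveOn_Ioo_union_Ioo hv hright
    (t := -t) ⟨neg_lt_neg hta, by linarith⟩ hε hτ
    (hτ0.trans (heq₁ ⟨neg_lt_neg hta, by linarith⟩).symm)
  refine ⟨γ₂, (heq₂ ⟨by linarith, by linarith⟩).trans (heq₁ ⟨by linarith, ha⟩), hγ₂.mono ?_⟩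
  rw [union_comm]
  exact Ioo_subset_Ioo_union_Ioo (by linarith) (by linarith) le_rfl

variable [FiniteDimensional ℝ E]

theorem exists_isMIntegralCurve_of_forall_mapsTo_isCompact (hv : CMDiff 1 (T% v)) {x : M}
    (h : ∀ R, ∃ K : Set M, IsCompact K ∧ ∀ a ≤ R, ∀ γ : ℝ → M, γ 0 = x →
      IsMIntegralCurveOn γ v (Ioo (-a) a) → MapsTo γ (Ioo (-a) a) K) :
    ∃ γ : ℝ → M, γ 0 = x ∧ IsMIntegralCurve γ v := by
  let times := {a | ∃ γ, γ 0 = x ∧ IsMIntegralCurveOn γ v (Ioo (-a) a)}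
  suffices hunbdd : ¬ BddAbove times by
    refine (exists_isMIntegralCurve_iff_exists_isMIntegralCurveOn_Ioo hv x).2 fun a ↦ ?_
    obtain ⟨b, ⟨γ, h0, hγ⟩, hab⟩ := not_bddAbove_iff.1 hunbdd a
    exact ⟨γ, h0, hγ.mono (Ioo_subset_Ioo (neg_le_neg hab.le) hab.le)⟩
  intro hbdd
  obtain ⟨δ, hδ, hδx⟩ := exists_forall_mem_isMIntegralCurveOn_of_isCompact hv
    (isCompact_singleton (x := x))
  have hδ_mem : δ ∈ times := hδx x rfl
  obtain ⟨K, hK, hKγ⟩ := h (sSup times)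
  obtain ⟨ε, hε, hεK⟩ := exists_forall_mem_isMIntegralCurveOn_of_isCompact hv hK
  obtain ⟨a, ⟨γ, h0, hγ⟩, ha⟩ : ∃ a ∈ times, max 0 (sSup times - ε / 2) < a :=
    exists_lt_of_lt_csSup ⟨δ, hδ_mem⟩
      (max_lt (hδ.trans_le (le_csSup hbdd hδ_mem)) (by linarith))
  rw [max_lt_iff] at ha
  have hmaps := hKγ a (le_csSup hbdd ⟨γ, h0, hγ⟩) γ h0 hγ
  obtain ⟨γ', h0', hγ'⟩ := exists_isMIntegralCurveOn_Ioo_add_half hv ha.1 hε hγ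
    fun t ht ↦ hεK _ (hmaps ht)
  linarith [le_csSup hbdd ⟨γ', h0'.trans h0, hγ'⟩]

end GlobalFlow

section IsMFlow

variable {E : Type*} [NormedAddCommGroup E] [NormedSpace ℝ E]
  {H : Type*} [TopologicalSpace H] {I : ModelWithCorners ℝ E H}
  {M : Type*} [TopologicalSpace M] [ChartedSpace H M]

/-- `Φ` is the global flow of the autonomous vector field `v`: the curve `Φ (x, ·)` is the integral
curve of `v` starting at `x`. No regularity in `x` is required. -/
structure IsMFlow (v : (x : M) → TangentSpace I x) (Φ : M × ℝ → M) : Prop where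
  map_zero : ∀ x, Φ (x, 0) = x
  isMIntegralCurve : ∀ x, IsMIntegralCurve (fun t ↦ Φ (x, t)) v

namespace IsMFlow

variable [IsManifold I 1 M] [BoundarylessManifold I M] [T2Space M]
  {v : (x : M) → TangentSpace I x} {Φ : M × ℝ → M}

theorem map_add (hΦ : IsMFlow v Φ) (hv : CMDiff 1 (T% v)) (x : M) (s t : ℝ) :
    Φ (x, s + t) = Φ (Φ (x, s), t) := by
  have heq := isMIntegralCurve_Ioo_eq_of_contMDiff_boundaryless (t₀ := 0) hv
    ((hΦ.isMIntegralCurve x).comp_add s) (hΦ.isMIntegralCurve (Φ (x, s)))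
    (by simp [hΦ.map_zero])
  simpa [add_comm] using congrFun heq t

theorem contMDiffAt_of_contMDiffAt_sub (hΦ : IsMFlow v Φ) (hv : CMDiff 1 (T% v)) {x : M} {s t : ℝ}
    (hs : ContMDiffAt (I.prod 𝓘(ℝ, ℝ)) I 1 Φ (x, s))
    (hts : ContMDiffAt (I.prod 𝓘(ℝ, ℝ)) I 1 Φ (Φ (x, s), t - s)) :
    ContMDiffAt (I.prod 𝓘(ℝ, ℝ)) I 1 Φ (x, t) := by
  have hsplit : Φ = fun p ↦ Φ (Φ (p.1, s), p.2 - s) := by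
    ext p
    rw [← hΦ.map_add hv, add_sub_cancel]
  rw [hsplit]
  have hfst : ContMDiffAt (I.prod 𝓘(ℝ, ℝ)) I 1 (fun p : M × ℝ ↦ Φ (p.1, s)) (x, t) :=
    ContMDiffAt.comp (x, t) (f := fun p : M × ℝ ↦ (p.1, s)) hs
      (contMDiffAt_fst.prodMk contMDiffAt_const)
  have hsnd : ContMDiffAt (I.prod 𝓘(ℝ, ℝ)) 𝓘(ℝ, ℝ) 1 (fun p : M × ℝ ↦ p.2 - s) (x, t) :=
    contMDiffAt_snd.sub contMDiffAt_const
  exact ContMDiffAt.comp (x, t) hts (hfst.prodMk hsnd)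

variable [FiniteDimensional ℝ E]

theorem eventually_contMDiffAt (hΦ : IsMFlow v Φ) (hv : CMDiff 1 (T% v)) (x : M) :
    ∀ᶠ p in 𝓝 (x, (0 : ℝ)), ContMDiffAt (I.prod 𝓘(ℝ, ℝ)) I 1 Φ p := by
  obtain ⟨ψ, hψ, U, hU, ε, hε, h⟩ :=
    exists_contMDiffAt_localFlow BoundarylessManifold.isInteriorPoint (hv x)
  have h0 : (0 : ℝ) ∈ Ioo (-ε) ε := ⟨neg_neg_of_pos hε, hε⟩
  have heq : Φ =ᶠ[𝓝 (x, 0)] ψ := by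
    filter_upwards [prod_mem_nhds hU (Ioo_mem_nhds h0.1 h0.2)] with p hp
    exact isMIntegralCurveOn_Ioo_eqOn_of_contMDiff_boundaryless h0 hv
      ((hΦ.isMIntegralCurve p.1).isMIntegralCurveOn _) (h p.1 hp.1).2
      (by rw [hΦ.map_zero, (h p.1 hp.1).1]) hp.2
  exact (contMDiffAt_iff_contMDiffAt_nhds (by simp)).1 (hψ.congr_of_eventuallyEq heq)

protected theorem contMDiff (hΦ : IsMFlow v Φ) (hv : CMDiff 1 (T% v)) :
    ContMDiff (I.prod 𝓘(ℝ, ℝ)) I 1 Φ := by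
  rintro ⟨x, t⟩
  suffices huniv : {t | ContMDiffAt (I.prod 𝓘(ℝ, ℝ)) I 1 Φ (x, t)} = univ from
    huniv.ge (mem_univ t)
  refine IsClopen.eq_univ ⟨isClosed_of_closure_subset fun t ht ↦ ?_,
    isOpen_iff_mem_nhds.2 fun t ht ↦ ?_⟩ ⟨0, (hΦ.eventually_contMDiffAt hv x).self_of_nhds⟩
  · have hlim : Tendsto (fun s ↦ (Φ (x, s), t - s)) (𝓝 t) (𝓝 (Φ (x, t), 0)) :=
      ((hΦ.isMIntegralCurve x).continuous.prodMk (continuous_sub_left t)).tendsto' _ _ (by simp)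
    obtain ⟨s, hs, hts⟩ := ((mem_closure_iff_frequently.1 ht).and_eventually
      (hlim.eventually (hΦ.eventually_contMDiffAt hv (Φ (x, t))))).exists
    exact hΦ.contMDiffAt_of_contMDiffAt_sub hv hs hts
  · have hlim : Tendsto (fun s ↦ (Φ (x, t), s - t)) (𝓝 t) (𝓝 (Φ (x, t), 0)) :=
      (continuous_const.prodMk (continuous_sub_right t)).tendsto' _ _ (by simp)
    filter_upwards [hlim.eventually (hΦ.eventually_contMDiffAt hv (Φ (x, t)))] with s hs
    exact hΦ.contMDiffAt_of_contMDiffAt_sub hv ht hs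

end IsMFlow

end IsMFlow

section Suspension

variable {E : Type*} [NormedAddCommGroup E] [NormedSpace ℝ E]
  {H : Type*} [TopologicalSpace H] {I : ModelWithCorners ℝ E H}
  {M : Type*} [TopologicalSpace M] [ChartedSpace H M]
  {f : (z : M) → ℝ → TangentSpace I z}

/-- The autonomous vector field `(f, 1)` on `M × ℝ`. Its integral curves are, up to a shift of
time, the curves `t ↦ (γ t, t)` with `γ` a solution of `γ'(t) = f (γ t, t)`. -/
def suspension (f : (z : M) → ℝ → TangentSpace I z) (p : M × ℝ) :
    TangentSpace (I.prod 𝓘(ℝ, ℝ)) p :=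
  ((f p.1 p.2, (1 : ℝ)) : E × ℝ)

theorem contMDiff_suspension [IsManifold I 1 M] (hf : IsC1TimeDependentField I f) :
    CMDiff 1 (T% (suspension f)) := by
  have hone : ContMDiff 𝓘(ℝ, ℝ) 𝓘(ℝ, ℝ).tangent 1
      (fun t : ℝ ↦ (⟨t, (1 : ℝ)⟩ : TangentBundle 𝓘(ℝ, ℝ) ℝ)) :=
    contMDiff_vectorSpace_iff_contDiff.2 contDiff_const
  exact contMDiff_equivTangentBundleProd_symm.comp
    (ContMDiff.prodMk hf (hone.comp contMDiff_snd))

theorem hasMFDerivAt_fst_of_suspension {γ : ℝ → M × ℝ} {t : ℝ}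
    (h : HasMFDerivAt 𝓘(ℝ, ℝ) (I.prod 𝓘(ℝ, ℝ)) γ t
      ((1 : ℝ →L[ℝ] ℝ).smulRight (suspension f (γ t)))) :
    HasMFDerivAt 𝓘(ℝ, ℝ) I (fun t ↦ (γ t).1) t
      ((1 : ℝ →L[ℝ] ℝ).smulRight (f (γ t).1 (γ t).2)) :=
  ((hasMFDerivAt_fst (γ t)).comp t h).congr_mfderiv rfl

theorem hasDerivAt_snd_of_suspension {γ : ℝ → M × ℝ} {t : ℝ}
    (h : HasMFDerivAt 𝓘(ℝ, ℝ) (I.prod 𝓘(ℝ, ℝ)) γ t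
      ((1 : ℝ →L[ℝ] ℝ).smulRight (suspension f (γ t)))) :
    HasDerivAt (fun t ↦ (γ t).2) 1 t := by
  have hsnd : HasFDerivAt (fun t ↦ (γ t).2) ((1 : ℝ →L[ℝ] ℝ).smulRight (1 : ℝ)) t :=
    hasMFDerivAt_iff_hasFDerivAt.1 (((hasMFDerivAt_snd (γ t)).comp t h).congr_mfderiv rfl)
  simpa using hsnd.hasDerivAt

theorem snd_sub_snd_eq_of_isMIntegralCurveOn_suspension {γ : ℝ → M × ℝ} {J : Set ℝ}
    (hJ : IsOpen J) (hJc : J.OrdConnected) (h : IsMIntegralCurveOn γ (suspension f) J) {s t : ℝ}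
    (hs : s ∈ J) (ht : t ∈ J) : (γ t).2 - (γ s).2 = t - s := by
  have hd (τ : ℝ) (hτ : τ ∈ J) : HasDerivWithinAt (fun t ↦ (γ t).2 - t) 0 J τ :=
    (((hasDerivAt_snd_of_suspension ((h τ hτ).hasMFDerivAt (hJ.mem_nhds hτ))).sub
      (hasDerivAt_id τ)).congr_deriv (sub_self 1)).hasDerivWithinAt
  have hconst := hJc.convex.norm_image_sub_le_of_norm_hasDerivWithin_le (C := 0) hd
    (fun _ _ ↦ norm_zero.le) hs ht
  rw [zero_mul, norm_le_zero_iff] at hconst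
  linarith

theorem SolvesOn.isMIntegralCurveOn_suspension {γ : ℝ → M} {J : Set ℝ} (h : SolvesOn I f γ J) :
    IsMIntegralCurveOn (fun t ↦ (γ t, t)) (suspension f) J := by
  intro t ht
  refine (((h t ht).prodMk (hasMFDerivAt_id t)).congr_mfderiv ?_).hasMFDerivWithinAt
  exact ContinuousLinearMap.ext fun x : ℝ ↦ Prod.ext rfl (mul_one (x : ℝ)).symm

theorem exists_Ioo_subset_of_isOpen_of_ordConnected {α : Type*} [TopologicalSpace α]
    [LinearOrder α] [OrderTopology α] [DenselyOrdered α] [NoMinOrder α] [NoMaxOrder α]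
    {J : Set α} (hJ : IsOpen J) (hJc : J.OrdConnected) {s t : α} (hs : s ∈ J) (ht : t ∈ J) :
    ∃ a b, s ∈ Ioo a b ∧ t ∈ Ioo a b ∧ Ioo a b ⊆ J := by
  obtain ⟨a, haJ, ha⟩ : ∃ a ∈ J, a < min s t :=
    Filter.nonempty_of_mem (inter_mem (mem_nhdsWithin_of_mem_nhds
      (hJ.mem_nhds (min_rec' (· ∈ J) hs ht))) (self_mem_nhdsWithin (s := Iio (min s t))))
  obtain ⟨b, hbJ, hb⟩ : ∃ b ∈ J, max s t < b :=
    Filter.nonempty_of_mem (inter_mem (mem_nhdsWithin_of_mem_nhds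
      (hJ.mem_nhds (max_rec' (· ∈ J) hs ht))) (self_mem_nhdsWithin (s := Ioi (max s t))))
  rw [lt_min_iff] at ha
  rw [max_lt_iff] at hb
  exact ⟨a, b, ⟨ha.1, hb.1⟩, ⟨ha.2, hb.2⟩, Ioo_subset_Icc_self.trans (hJc.out haJ hbJ)⟩

variable [IsManifold I 1 M] [BoundarylessManifold I M] [T2Space M]

theorem SolvesOn.eqOn (hf : IsC1TimeDependentField I f) {γ γ' : ℝ → M} {J : Set ℝ} {t₀ : ℝ}
    (hJ : IsOpen J) (hJc : J.OrdConnected) (ht₀ : t₀ ∈ J) (hγ : SolvesOn I f γ J)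
    (hγ' : SolvesOn I f γ' J) (h : γ t₀ = γ' t₀) : EqOn γ γ' J := by
  intro t ht
  obtain ⟨a, b, ht₀', ht', hab⟩ := exists_Ioo_subset_of_isOpen_of_ordConnected hJ hJc ht₀ ht
  have heq := isMIntegralCurveOn_Ioo_eqOn_of_contMDiff_boundaryless ht₀' (contMDiff_suspension hf)
    (hγ.isMIntegralCurveOn_suspension.mono hab) (hγ'.isMIntegralCurveOn_suspension.mono hab)
    (congrArg (·, t₀) h)
  exact congrArg Prod.fst (heq ht')

end Suspension

namespace IsMFlow

variable {E : Type*} [NormedAddCommGroup E] [NormedSpace ℝ E]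
  {H : Type*} [TopologicalSpace H] {I : ModelWithCorners ℝ E H}
  {M : Type*} [TopologicalSpace M] [ChartedSpace H M]
  {f : (z : M) → ℝ → TangentSpace I z} {Φ : (M × ℝ) × ℝ → M × ℝ}

theorem snd_suspension (hΦ : IsMFlow (suspension f) Φ) (w : M × ℝ) (t : ℝ) :
    (Φ (w, t)).2 = w.2 + t := by
  have h := snd_sub_snd_eq_of_isMIntegralCurveOn_suspension isOpen_univ ordConnected_univ
    ((hΦ.isMIntegralCurve w).isMIntegralCurveOn univ) (mem_univ 0) (mem_univ t)
  rw [hΦ.map_zero] at h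
  linarith

variable [IsManifold I 1 M] [BoundarylessManifold I M] [T2Space M]

theorem fst_suspension_fst_suspension (hΦ : IsMFlow (suspension f) Φ)
    (hf : IsC1TimeDependentField I f) (z : M) (s t : ℝ) :
    (Φ (((Φ ((z, s), t)).1, s + t), -t)).1 = z := by
  have hpair : ((Φ ((z, s), t)).1, s + t) = Φ ((z, s), t) :=
    Prod.ext rfl (hΦ.snd_suspension (z, s) t).symm
  rw [hpair, ← hΦ.map_add (contMDiff_suspension hf), add_neg_cancel, hΦ.map_zero]

variable [FiniteDimensional ℝ E]

theorem isGlobalFlow (hΦ : IsMFlow (suspension f) Φ) (hf : IsC1TimeDependentField I f) :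
    IsGlobalFlow I f (fun p ↦ (Φ ((p.1, 0), p.2)).1) where
  contMDiff := contMDiff_fst.comp ((hΦ.contMDiff (contMDiff_suspension hf)).comp
    ((contMDiff_fst.prodMk contMDiff_const).prodMk contMDiff_snd))
  map_zero z := by rw [hΦ.map_zero]
  solves z t _ := by
    simpa only [hΦ.snd_suspension, zero_add] using
      hasMFDerivAt_fst_of_suspension (hΦ.isMIntegralCurve (z, 0) t)

theorem exists_diffeomorph (hΦ : IsMFlow (suspension f) Φ) (hf : IsC1TimeDependentField I f)
    (t : ℝ) : ∃ Ψ : M ≃ₘ^1⟮I, I⟯ M, ∀ z, Ψ z = (Φ ((z, 0), t)).1 := by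
  have hsmooth (r s : ℝ) : ContMDiff I I 1 (fun z ↦ (Φ ((z, r), s)).1) :=
    contMDiff_fst.comp ((hΦ.contMDiff (contMDiff_suspension hf)).comp
      ((contMDiff_id.prodMk contMDiff_const).prodMk contMDiff_const))
  refine ⟨⟨⟨fun z ↦ (Φ ((z, 0), t)).1, fun z ↦ (Φ ((z, t), -t)).1, fun z ↦ ?_, fun z ↦ ?_⟩,
    hsmooth 0 t, hsmooth t (-t)⟩, fun _ ↦ rfl⟩
  · simpa using hΦ.fst_suspension_fst_suspension hf z 0 t
  · simpa using hΦ.fst_suspension_fst_suspension hf z t (-t)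

end IsMFlow

section Riemannian

variable {E : Type*} [NormedAddCommGroup E] [NormedSpace ℝ E]
  {H : Type*} [TopologicalSpace H] {I : ModelWithCorners ℝ E H}
  {M : Type*} [EMetricSpace M] [ChartedSpace H M]
  [Bundle.RiemannianBundle (fun z : M ↦ TangentSpace I z)] [IsRiemannianManifold I M]

theorem edist_le_of_norm_mfderiv_le {γ : ℝ → M} {s t c : ℝ} (hst : s ≤ t)
    (hγ : ContMDiffOn 𝓘(ℝ, ℝ) I 1 γ (Icc s t))
    (hc : ∀ τ ∈ Ioo s t, ‖mfderiv 𝓘(ℝ, ℝ) I γ τ (1 : ℝ)‖ ≤ c) :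
    edist (γ s) (γ t) ≤ ENNReal.ofReal (c * (t - s)) :=
  calc edist (γ s) (γ t)
      ≤ ∫⁻ τ in Ioo s t, ‖mfderiv 𝓘(ℝ, ℝ) I γ τ (1 : ℝ)‖ₑ :=
        (edist_le_pathELength hγ hst).trans_eq pathELength_eq_lintegral_mfderiv_Ioo
    _ ≤ ∫⁻ _ in Ioo s t, ENNReal.ofReal c :=
        setLIntegral_mono' measurableSet_Ioo fun τ hτ ↦
          (ofReal_norm _).symm.trans_le (ENNReal.ofReal_le_ofReal (hc τ hτ))
    _ = ENNReal.ofReal (c * (t - s)) := by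
        rw [setLIntegral_const, Real.volume_Ioo, ENNReal.ofReal_mul' (sub_nonneg.2 hst)]

variable [FiniteDimensional ℝ E] [IsManifold I 1 M] [BoundarylessManifold I M]
  {f : (z : M) → ℝ → TangentSpace I z}

theorem edist_fst_le_of_isMIntegralCurveOn_suspension (hf : IsC1TimeDependentField I f)
    {γ : ℝ → M × ℝ} {J : Set ℝ} (hJ : IsOpen J) (hJc : J.OrdConnected)
    (hγ : IsMIntegralCurveOn γ (suspension f) J) {c : ℝ}
    (hc : ∀ τ ∈ J, ‖f (γ τ).1 (γ τ).2‖ ≤ c) {s t : ℝ} (hs : s ∈ J) (ht : t ∈ J) :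
    edist (γ s).1 (γ t).1 ≤ ENNReal.ofReal (c * |t - s|) := by
  wlog hst : s ≤ t generalizing s t
  · rw [edist_comm, abs_sub_comm]
    exact this ht hs (le_of_not_ge hst)
  rw [abs_of_nonneg (sub_nonneg.2 hst)]
  have hsub : Icc s t ⊆ J := hJc.out hs ht
  refine edist_le_of_norm_mfderiv_le (I := I) (γ := fun t ↦ (γ t).1) hst (fun τ hτ ↦ ?_)
    fun τ hτ ↦ ?_
  · have hγτ : ContMDiffAt 𝓘(ℝ, ℝ) (I.prod 𝓘(ℝ, ℝ)) 1 γ τ := contMDiffAt_of_isMIntegralCurveAt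
      (contMDiff_suspension hf _) (hγ.isMIntegralCurveAt (hJ.mem_nhds (hsub hτ)))
    exact (contMDiffAt_fst.comp τ hγτ).contMDiffWithinAt
  · have hτJ := hsub (Ioo_subset_Icc_self hτ)
    rw [(hasMFDerivAt_fst_of_suspension ((hγ τ hτJ).hasMFDerivAt (hJ.mem_nhds hτJ))).mfderiv]
    exact (congrArg norm (one_smul ℝ (f (γ τ).1 (γ τ).2))).trans_le (hc τ hτJ)

theorem exists_isMIntegralCurve_suspension (hf : IsC1TimeDependentField I f)
    (hbdd : ∀ T, ∃ c, ∀ z t, |t| ≤ T → ‖f z t‖ ≤ c)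
    (hcompact : ∀ (p : M) (R : ℝ≥0), IsCompact (Metric.closedEBall p R)) (w : M × ℝ) :
    ∃ γ : ℝ → M × ℝ, γ 0 = w ∧ IsMIntegralCurve γ (suspension f) := by
  refine exists_isMIntegralCurve_of_forall_mapsTo_isCompact (contMDiff_suspension hf) fun R ↦ ?_
  obtain ⟨c, hc⟩ := hbdd (|w.2| + R)
  refine ⟨Metric.closedEBall w.1 (|c| * R).toNNReal ×ˢ Icc (w.2 - R) (w.2 + R),
    (hcompact _ _).prod isCompact_Icc, fun a ha γ h0 hγ t ht ↦ ?_⟩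
  have h0a : (0 : ℝ) ∈ Ioo (-a) a := by
    rw [mem_Ioo, neg_lt_zero, and_self]
    linarith [ht.1, ht.2]
  have hsnd {τ : ℝ} (hτ : τ ∈ Ioo (-a) a) : (γ τ).2 = w.2 + τ := by
    have h := snd_sub_snd_eq_of_isMIntegralCurveOn_suspension isOpen_Ioo ordConnected_Ioo hγ h0a hτ
    rw [h0] at h
    linarith
  have habs {τ : ℝ} (hτ : τ ∈ Ioo (-a) a) : |τ| ≤ R := (abs_lt.2 hτ).le.trans ha
  have hspeed (τ : ℝ) (hτ : τ ∈ Ioo (-a) a) : ‖f (γ τ).1 (γ τ).2‖ ≤ |c| :=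
    (hc _ _ (by grw [hsnd hτ, abs_add_le, habs hτ])).trans (le_abs_self c)
  have hdist := edist_fst_le_of_isMIntegralCurveOn_suspension hf isOpen_Ioo ordConnected_Ioo hγ
    hspeed ht h0a
  rw [h0, zero_sub, abs_neg] at hdist
  refine ⟨hdist.trans (ENNReal.ofReal_le_ofReal
    (mul_le_mul_of_nonneg_left (habs ht) (abs_nonneg c))), ?_⟩
  rw [hsnd ht]
  constructor <;> linarith [ht.1, ht.2]

end Riemannian

theorem proposition1_general
    {E : Type*} [NormedAddCommGroup E] [NormedSpace ℝ E] [FiniteDimensional ℝ E]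
    {H : Type*} [TopologicalSpace H] (I : ModelWithCorners ℝ E H)
    {M : Type*} [EMetricSpace M] [ChartedSpace H M] [IsManifold I 1 M] [BoundarylessManifold I M]
    [Bundle.RiemannianBundle (fun z : M ↦ TangentSpace I z)] [IsRiemannianManifold I M]
    (hM : GeodesicallyComplete M)
    (f : (z : M) → ℝ → TangentSpace I z)
    (hf : IsC1TimeDependentField I f)
    (hbdd : ∀ T : ℝ, ∃ c : ℝ, ∀ (z : M) (t : ℝ), |t| ≤ T → ‖f z t‖ ≤ c) :
    ∃ φ : M × ℝ → M,
      IsGlobalFlow I f φ ∧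
      (∀ (γ : ℝ → M) (J : Set ℝ), IsOpen J → J.OrdConnected → (0 : ℝ) ∈ J →
        SolvesOn I f γ J → Set.EqOn γ (fun t ↦ φ (γ 0, t)) J) ∧
      ∀ t : ℝ, ∃ Φ : M ≃ₘ^1⟮I, I⟯ M, ∀ z, Φ z = φ (z, t) := by
  have : LocallyCompactSpace M := Manifold.locallyCompact_of_finiteDimensional I
  have hcompact := (isLengthSpace_of_isRiemannianManifold I M).isCompact_closedEBall hM
  choose Γ hΓ0 hΓ using exists_isMIntegralCurve_suspension hf hbdd hcompact
  have hΦ : IsMFlow (suspension f) (fun p ↦ Γ p.1 p.2) := ⟨hΓ0, hΓ⟩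
  have hφ := hΦ.isGlobalFlow hf
  exact ⟨_, hφ, fun γ J hJ hJc h0 hγ ↦ hγ.eqOn hf hJ hJc h0
    (fun t _ ↦ hφ.solves (γ 0) t (mem_univ t)) (hφ.map_zero (γ 0)).symm, hΦ.exists_diffeomorph hf⟩

theorem proposition1
    {E : Type*} [NormedAddCommGroup E] [NormedSpace ℝ E] [FiniteDimensional ℝ E]
    {H : Type*} [TopologicalSpace H] (I : ModelWithCorners ℝ E H) [I.Boundaryless]
    {M : Type*} [EMetricSpace M] [ChartedSpace H M] [IsManifold I ∞ M]
    [Bundle.RiemannianBundle (fun z : M ↦ TangentSpace I z)]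
    [IsContMDiffRiemannianBundle I ∞ E (fun z : M ↦ TangentSpace I z)]
    [IsRiemannianManifold I M]
    (hM : GeodesicallyComplete M)
    (f : (z : M) → ℝ → TangentSpace I z)
    (hf : IsC1TimeDependentField I f)
    (hbdd : ∃ c : ℝ, ∀ (z : M) (t : ℝ), ‖f z t‖ ≤ c) :
    ∃ φ : M × ℝ → M,
      IsGlobalFlow I f φ ∧
      (∀ (γ : ℝ → M) (J : Set ℝ), IsOpen J → J.OrdConnected → (0 : ℝ) ∈ J →
        SolvesOn I f γ J → Set.EqOn γ (fun t ↦ φ (γ 0, t)) J) ∧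
      ∀ t : ℝ, ∃ Φ : M ≃ₘ^1⟮I, I⟯ M, ∀ z, Φ z = φ (z, t) :=
  proposition1_general I hM f hf fun _ ↦ hbdd.imp fun _ hc z t _ ↦ hc z t
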